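/- Let $A = V/\Lambda$ be an abelian surface over $\mathbb{C}$, where $V$ is a $2$-dimensional complex vector space and $\Lambda \subset V$ is a lattice. Let $\mathrm{NS}(A)$ be its Néron–Severi group, that is, the group of first Chern classes of holomorphic line bundles on $A$, viewed as integral alternating forms on $\Lambda = H_1(A,\mathbb{Z})$. A class in $\mathrm{NS}(A)$ is a polarization if it is the restriction to $\Lambda$ of the imaginary part of a positive definite Hermitian form on $V$, and a polarization is principal if it is unimodular on $\Lambda$. Suppose that $A$ has two different principal polarizations $\theta \neq \theta' \in \mathrm{NS}(A)$. Then $A$ admits real multiplication, i.e. there is an integer $d \geq 2$ which is not a square such that the ring $\mathrm{End}_{\mathbb{Q}}(A) = \mathrm{End}(A) \otimes_{\mathbb{Z}} \mathbb{Q}$ contains a subring isomorphic to the field $\mathbb{Q}(\sqrt{d})$. -/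

import Mathlib

open scoped Topology ComplexConjugate TensorProduct IntermediateField

/-! Complex tori `A = V / Λ`: `V` is a finite-dimensional complex vector space and `Λ` is a lattice
in it (`DiscreteTopology Λ` and `IsZLattice ℝ Λ`). An abelian variety over `ℂ` is a complex torus
which has a polarization. -/

namespace ComplexTorus

variable {V : Type*} [NormedAddCommGroup V] [NormedSpace ℂ V]

/-- A group endomorphism `f` of `V / Λ` is holomorphic if it is holomorphic in the charts given by
the projection `V → V / Λ`: around each `v : V`, it lifts to a holomorphic map between open
subsets of `V`. -/
def IsHolomorphic (Λ : Submodule ℤ V) (f : AddMonoid.End (V ⧸ Λ)) : Prop :=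
  ∀ v : V, ∃ g : V → V, AnalyticAt ℂ g v ∧
    ∀ᶠ u in 𝓝 v, f (Submodule.Quotient.mk u) = Submodule.Quotient.mk (g u)

/-- The ring `End(A)` of holomorphic group endomorphisms of `A = V / Λ`; the multiplication is
the composition. -/
def endRing (Λ : Submodule ℤ V) : Subring (AddMonoid.End (V ⧸ Λ)) where
  carrier := {f | IsHolomorphic Λ f}
  mul_mem' := by
    intro f₁ f₂ h₁ h₂ v
    obtain ⟨g₂, hg₂, e₂⟩ := h₂ v
    obtain ⟨g₁, hg₁, e₁⟩ := h₁ (g₂ v)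
    refine ⟨g₁ ∘ g₂, hg₁.comp hg₂, ?_⟩
    filter_upwards [e₂, hg₂.continuousAt.eventually e₁] with u hu hu'
    change f₁ (f₂ _) = _
    rw [hu, hu']
    rfl
  one_mem' := fun v => ⟨id, analyticAt_id, Filter.Eventually.of_forall fun _ => rfl⟩
  add_mem' := by
    intro f₁ f₂ h₁ h₂ v
    obtain ⟨g₁, hg₁, e₁⟩ := h₁ v
    obtain ⟨g₂, hg₂, e₂⟩ := h₂ v
    refine ⟨g₁ + g₂, hg₁.add hg₂, ?_⟩
    filter_upwards [e₁, e₂] with u hu hu'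
    change f₁ _ + f₂ _ = _
    rw [hu, hu']
    rfl
  zero_mem' := fun v => ⟨0, analyticAt_const, Filter.Eventually.of_forall fun _ => rfl⟩
  neg_mem' := by
    intro f h v
    obtain ⟨g, hg, e⟩ := h v
    refine ⟨-g, hg.neg, ?_⟩
    filter_upwards [e] with u hu
    change -f _ = _
    rw [hu]
    rfl

/-- The ring `End_ℚ(A) = End(A) ⊗_ℤ ℚ`. -/
abbrev EndQ (Λ : Submodule ℤ V) : Type _ := endRing Λ ⊗[ℤ] ℚ

/-- `A = V / Λ` admits real multiplication if `End_ℚ(A)` contains a subring isomorphic to the field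
`ℚ(√d)` for some integer `d ≥ 2` which is not a square. -/
def AdmitsRealMultiplication (Λ : Submodule ℤ V) : Prop :=
  ∃ d : ℕ, 2 ≤ d ∧ ¬ IsSquare d ∧
    ∃ R : Subring (EndQ Λ), Nonempty (R ≃+* ℚ⟮Real.sqrt (d : ℝ)⟯)

/-- A holomorphic line bundle on `A = V / Λ`, given by a factor of automorphy `e`: it is the
quotient of `V × ℂ` by the action `l • (v, t) = (v + l, e l v * t)` of `Λ`. -/
structure LineBundle (Λ : Submodule ℤ V) where
  e : Λ → V → ℂ
  ne_zero : ∀ l v, e l v ≠ 0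
  holomorphic : ∀ l, Differentiable ℂ (e l)
  cocycle : ∀ (l m : Λ) (v : V), e (l + m) v = e l (v + m) * e m v

/-- `E` is the first Chern class of the line bundle `L`. Here `H²(A, ℤ)` is the group of alternating
integral forms on `H₁(A, ℤ) = Λ`. Writing `L.e l v = exp (2 π i g(l, v))` with each `g(l, ·)`
holomorphic, the class is the form
`(l, m) ↦ g(m, v + l) + g(l, v) - g(l, v + m) - g(m, v)`,
which depends neither on `v` nor on the choice of the logarithms `g(l, ·)`. -/
def IsChernClass {Λ : Submodule ℤ V} (L : LineBundle Λ) (E : LinearMap.BilinForm ℤ Λ) : Prop :=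
  ∃ g : Λ → V → ℂ, (∀ l, Differentiable ℂ (g l)) ∧
    (∀ l v, L.e l v = Complex.exp (2 * Real.pi * Complex.I * g l v)) ∧
    ∀ (l m : Λ) (v : V), (E l m : ℂ) = g m (v + l) + g l v - g l (v + m) - g m v

/-- The Néron-Severi group `NS(A)`: the subgroup of `H²(A, ℤ)` formed by the first Chern classes of
the holomorphic line bundles on `A`. (These forms are automatically alternating.) -/
def NS (Λ : Submodule ℤ V) : AddSubgroup (LinearMap.BilinForm ℤ Λ) where
  carrier := {E | ∃ L : LineBundle Λ, IsChernClass L E}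
  zero_mem' := ⟨⟨fun _ _ => 1, by simp, fun _ => differentiable_const _, by simp⟩,
    fun _ _ => 0, fun _ => differentiable_const _, by simp, by simp⟩
  add_mem' := by
    rintro E₁ E₂ ⟨L₁, g₁, d₁, h₁, c₁⟩ ⟨L₂, g₂, d₂, h₂, c₂⟩
    refine ⟨⟨fun l v => L₁.e l v * L₂.e l v, fun l v => mul_ne_zero (L₁.ne_zero l v) (L₂.ne_zero l v),
      fun l => (L₁.holomorphic l).mul (L₂.holomorphic l), fun l m v => ?_⟩,
      fun l v => g₁ l v + g₂ l v, fun l => (d₁ l).add (d₂ l), fun l v => ?_, fun l m v => ?_⟩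
    · rw [L₁.cocycle, L₂.cocycle]; ring
    · simp only [h₁, h₂]
      rw [← Complex.exp_add]; congr 1; ring
    · rw [LinearMap.add_apply, LinearMap.add_apply, Int.cast_add, c₁ l m v, c₂ l m v]; ring
  neg_mem' := by
    rintro E ⟨L, g, d, h, c⟩
    refine ⟨⟨fun l v => (L.e l v)⁻¹, fun l v => inv_ne_zero (L.ne_zero l v),
      fun l => (L.holomorphic l).inv (L.ne_zero l), fun l m v => ?_⟩,
      fun l v => -g l v, fun l => (d l).neg, fun l v => ?_, fun l m v => ?_⟩
    · rw [L.cocycle, mul_inv]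
    · simp only [h]
      rw [← Complex.exp_neg]; congr 1; ring
    · rw [LinearMap.neg_apply, LinearMap.neg_apply, Int.cast_neg, c l m v]; ring

/-- A class `θ` in `NS(A)` is a polarization if it is the class of a positive line bundle, that is,
if `θ` is the imaginary part, on `Λ`, of a positive definite Hermitian form `H` on `V`
(linear in the first variable; `Λ` spans `V` over `ℝ`, so `H` is unique). -/
def IsPolarization {Λ : Submodule ℤ V} (θ : NS Λ) : Prop :=
  ∃ H : V →ₗ[ℂ] V →ₗ⋆[ℂ] ℂ, (∀ u v, conj (H u v) = H v u) ∧ (∀ v, v ≠ 0 → 0 < (H v v).re) ∧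
    ∀ l m : Λ, (H (l : V) (m : V)).im = (θ.1 l m : ℝ)

/-- A polarization `θ` is principal if it is unimodular, that is, if it induces an isomorphism
of `Λ` with its `ℤ`-dual (equivalently, of `A` with the dual torus). -/
def IsPrincipalPolarization {Λ : Submodule ℤ V} (θ : NS Λ) : Prop :=
  IsPolarization θ ∧ Function.Bijective (fun l : Λ => (θ.1 l : Module.Dual ℤ Λ))

end ComplexTorus

/-!
Let `E`, `E'` be the unimodular forms on `Λ` given by two principal polarizations, the imaginary
parts of positive definite Hermitian forms `H`, `H'`. Unimodularity of both gives an automorphism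
`f` of `Λ` with `E' l m = E (f l) m`. Its real-linear extension `ψ` to `V` is complex-linear, and
`H' u v = H (ψ u) v` (`exists_extension`, `exists_complexLinear_of_im_eq`); so `ψ` is an
automorphism of `A = V / Λ`, it is self-adjoint for `H`, and its eigenvalues `r`, `s` are real and
positive (`exists_pos_of_hasEigenvalue`).

The determinant of `f` is `±1` and equals `(r s)²`, hence `r s = 1`. By Cayley-Hamilton
`ψ² + 1 = (r + s) ψ`, so that multiplication by the real number `r + s` preserves `Λ`, and
`n = r + s` is an integer (`exists_int_eq_of_smul_mem`), with `n ≥ 2` because `r s = 1`. If `n = 2`,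
then `ψ` is unipotent and self-adjoint, thus the identity, and the polarizations coincide.
Otherwise `n ≥ 3`, the integer `n² - 4` is not a square, and `(2 ψ - n)² = n² - 4`, so that
`2 ψ - n` generates a copy of `ℚ(√(n² - 4))` in `End_ℚ(A)`
(`admitsRealMultiplication_of_quadratic`).
-/

namespace ComplexTorus

/-! ### Endomorphisms of a complex plane -/

theorem exists_eigenvalues_of_finrank_eq_two {V : Type*} [AddCommGroup V] [Module ℂ V]
    (hV : Module.finrank ℂ V = 2) (f : Module.End ℂ V) :
    ∃ a b : ℂ, f.HasEigenvalue a ∧ f.HasEigenvalue b ∧ LinearMap.det f = a * b ∧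
      ∀ v, f (f v) - (a + b) • f v + (a * b) • v = 0 := by
  have : FiniteDimensional ℂ V := .of_finrank_pos (by omega)
  have hdeg : f.charpoly.natDegree = 2 := by rw [LinearMap.charpoly_natDegree, hV]
  have hcard : f.charpoly.roots.card = 2 := by
    rw [← hdeg]; exact (IsAlgClosed.splits f.charpoly).natDegree_eq_card_roots.symm
  obtain ⟨a, b, hab⟩ := Multiset.card_eq_two.1 hcard
  have hp : f.charpoly = (Polynomial.X - Polynomial.C a) * (Polynomial.X - Polynomial.C b) := by
    rw [(IsAlgClosed.splits f.charpoly).eq_prod_roots_of_monic f.charpoly_monic, hab]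
    simp
  have hev : ∀ c ∈ f.charpoly.roots, f.HasEigenvalue c := fun c hc =>
    (Module.End.hasEigenvalue_iff_isRoot_charpoly f c).2 (Polynomial.isRoot_of_mem_roots hc)
  refine ⟨a, b, hev a (by simp [hab]), hev b (by simp [hab]), ?_, fun v => ?_⟩
  · rw [LinearMap.det_eq_sign_charpoly_coeff, hV, hp, Polynomial.coeff_zero_eq_eval_zero]
    simp
  · have h := LinearMap.congr_fun (LinearMap.aeval_self_charpoly f) v
    rw [hp] at h
    simp only [map_mul, map_sub, Polynomial.aeval_X, Polynomial.aeval_C, Module.End.mul_apply,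
      LinearMap.sub_apply, Module.algebraMap_end_apply, LinearMap.zero_apply, map_smul] at h
    rw [← h]
    module

/-! ### Comparison of two positive definite Hermitian forms -/

section Hermitian

variable {V : Type*} [AddCommGroup V] [Module ℂ V] {H H' : V →ₗ[ℂ] V →ₗ⋆[ℂ] ℂ}

/-- The imaginary part of a positive definite Hermitian form `H` is nondegenerate, because
`H u (i u) = -i H u u`. -/
theorem eq_of_forall_im_eq (hpos : ∀ v, v ≠ 0 → 0 < (H v v).re) {u w : V}
    (h : ∀ v, (H u v).im = (H w v).im) : u = w := by
  by_contra hne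
  have hz : ∀ v, (H (u - w) v).im = 0 := fun v => by simp [h v]
  have h1 := hpos _ (sub_ne_zero.2 hne)
  have h2 := hz (Complex.I • (u - w))
  simp only [map_smulₛₗ, smul_eq_mul, Complex.conj_I, Complex.mul_im, Complex.neg_re,
    Complex.neg_im, Complex.I_re, Complex.I_im] at h2
  linarith

/-- If a real-linear map intertwines the imaginary parts of two Hermitian forms, then it is
complex-linear, because the imaginary part of a positive definite form is nondegenerate, and it
intertwines the forms themselves. -/
theorem exists_complexLinear_of_im_eq (hpos : ∀ v, v ≠ 0 → 0 < (H v v).re) (φ : V →ₗ[ℝ] V)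
    (hφ : ∀ u v, (H' u v).im = (H (φ u) v).im) :
    ∃ ψ : V →ₗ[ℂ] V, (∀ v, ψ v = φ v) ∧ ∀ u v, H' u v = H (ψ u) v := by
  have hI : ∀ u, φ (Complex.I • u) = Complex.I • φ u := fun u => by
    refine eq_of_forall_im_eq hpos fun v => ?_
    have h := hφ u (Complex.I • v)
    rw [← hφ]
    simp only [map_smulₛₗ, smul_eq_mul, Complex.conj_I, Complex.mul_im, Complex.neg_re,
      Complex.neg_im, Complex.I_re, Complex.I_im, LinearMap.smul_apply, RingHom.id_apply] at h ⊢
    linarith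
  refine ⟨{ φ with
    map_smul' := fun c u => ?_ }, fun v => rfl, fun u v => ?_⟩
  · have hc : ∀ w : V, c • w = c.re • w + c.im • (Complex.I • w) := fun w => by
      conv_lhs => rw [← Complex.re_add_im c, add_smul, mul_smul]
      simp only [Complex.coe_smul]
    change φ (c • u) = c • φ u
    rw [hc, hc, map_add, map_smul, map_smul, hI]
  · have h := hφ u (Complex.I • v)
    simp only [map_smulₛₗ, smul_eq_mul, Complex.conj_I, Complex.mul_im, Complex.neg_re,
      Complex.neg_im, Complex.I_re, Complex.I_im] at h
    refine Complex.ext ?_ (hφ u v)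
    change (H' u v).re = (H (φ u) v).re
    linarith

/-- The eigenvalues of an endomorphism relating two positive definite Hermitian forms are
quotients of values of these forms. -/
theorem exists_pos_of_hasEigenvalue (hsymm : ∀ u v, conj (H u v) = H v u)
    (hsymm' : ∀ u v, conj (H' u v) = H' v u)
    (hpos : ∀ v, v ≠ 0 → 0 < (H v v).re) (hpos' : ∀ v, v ≠ 0 → 0 < (H' v v).re)
    {ψ : Module.End ℂ V} (hψ : ∀ u v, H' u v = H (ψ u) v) {c : ℂ} (hc : ψ.HasEigenvalue c) :
    ∃ r : ℝ, 0 < r ∧ (r : ℂ) = c := by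
  obtain ⟨v, hv⟩ := hc.exists_hasEigenvector
  have h := hψ v v
  rw [hv.apply_eq_smul, map_smul, LinearMap.smul_apply, smul_eq_mul,
    ← Complex.conj_eq_iff_re.1 (hsymm v v), ← Complex.conj_eq_iff_re.1 (hsymm' v v)] at h
  have h1 := hpos v hv.2
  refine ⟨(H' v v).re / (H v v).re, div_pos (hpos' v hv.2) h1, ?_⟩
  rw [Complex.ofReal_div, h, mul_div_cancel_right₀]
  exact_mod_cast h1.ne'

/-- An endomorphism `ψ` with `(ψ - 1)² = 0` which is self-adjoint for `H` is the identity, because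
`H ((ψ - 1) v) ((ψ - 1) v) = H ((ψ - 1)² v) v = 0`. -/
theorem apply_eq_self_of_unipotent (hsymm : ∀ u v, conj (H u v) = H v u)
    (hsymm' : ∀ u v, conj (H' u v) = H' v u) (hpos : ∀ v, v ≠ 0 → 0 < (H v v).re)
    {ψ : Module.End ℂ V} (hψ : ∀ u v, H' u v = H (ψ u) v)
    (huni : ∀ v, ψ (ψ v) - (2 : ℂ) • ψ v + v = 0) (v : V) : ψ v = v := by
  by_contra hne
  have hadj : ∀ u w, H (ψ u) w = H u (ψ w) := fun u w => by
    rw [← hψ, ← hsymm', hψ, hsymm]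
  have h1 := hpos _ (sub_ne_zero.2 hne)
  have h2 : ψ (ψ v - v) - (ψ v - v) = 0 := by
    rw [← huni v, map_sub]; module
  have h3 : H (ψ v - v) (ψ v - v) = H (ψ (ψ v - v) - (ψ v - v)) v := by
    simp only [map_sub, LinearMap.sub_apply, hadj]
  rw [h3, h2] at h1
  simp at h1

end Hermitian

/-! ### Linear maps preserving a lattice -/

section Lattice

variable {V : Type*} [NormedAddCommGroup V] [NormedSpace ℂ V] [FiniteDimensional ℂ V]
  (Λ : Submodule ℤ V) [DiscreteTopology Λ] [IsZLattice ℝ Λ]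

/-- A `ℤ`-basis of `Λ` is an `ℝ`-basis of `V`, with the same coordinates on `Λ`. -/
theorem exists_basis : ∃ (ι : Type) (_ : Fintype ι) (b : Module.Basis ι ℤ Λ)
    (B : Module.Basis ι ℝ V), (∀ i, B i = b i) ∧ ∀ (l : Λ) i, B.repr l i = b.repr l i := by
  have : FiniteDimensional ℝ V := FiniteDimensional.complexToReal V
  have : Module.Finite ℤ Λ := ZLattice.module_finite ℝ Λ
  have : Module.Free ℤ Λ := ZLattice.module_free ℝ Λ
  let b := Module.finBasis ℤ Λ
  exact ⟨_, inferInstance, b, b.ofZLatticeBasis ℝ Λ, b.ofZLatticeBasis_apply ℝ Λ,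
    b.ofZLatticeBasis_repr_apply ℝ Λ⟩

/-- A real number `t` with `t Λ ⊆ Λ` is an integer. -/
theorem exists_int_eq_of_smul_mem [Nontrivial V] {t : ℝ} (ht : ∀ l : Λ, t • (l : V) ∈ Λ) :
    ∃ n : ℤ, (n : ℝ) = t := by
  obtain ⟨ι, _, b, B, hB, hrepr⟩ := exists_basis Λ
  obtain ⟨i⟩ := B.index_nonempty
  refine ⟨b.repr ⟨_, ht (b i)⟩ i, ?_⟩
  rw [← hrepr, map_smul, ← hB]
  simp

theorem det_eq_of_extends {φ : V →ₗ[ℝ] V} {f : Λ →ₗ[ℤ] Λ} (h : ∀ l : Λ, φ l = f l) :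
    LinearMap.det φ = (LinearMap.det f : ℤ) := by
  classical
  obtain ⟨ι, _, b, B, hB, hrepr⟩ := exists_basis Λ
  rw [← LinearMap.det_toMatrix B, ← LinearMap.det_toMatrix b, Int.cast_det]
  congr 1
  ext i j
  rw [LinearMap.toMatrix_apply, Matrix.map_apply, LinearMap.toMatrix_apply, hB, h, hrepr]

/-- A nonzero integer does not annihilate the torus `V / Λ`. -/
theorem exists_zsmul_quotient_ne_zero [Nontrivial V] {n : ℤ} (hn : n ≠ 0) :
    ∃ v : V ⧸ Λ, n • v ≠ 0 := by
  by_contra! h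
  -- If `n` annihilates `V / Λ`, then `V = n V ⊆ Λ`, so that `Λ` is stable under `1 / 2`.
  obtain ⟨k, hk⟩ := exists_int_eq_of_smul_mem Λ (t := 1 / 2) fun l => by
    have hl := h (Submodule.Quotient.mk ((n : ℝ)⁻¹ • (1 / 2 : ℝ) • (l : V)))
    rw [← Submodule.Quotient.mk_smul, Submodule.Quotient.mk_eq_zero, ← Int.cast_smul_eq_zsmul ℝ,
      smul_inv_smul₀ (by exact_mod_cast hn)] at hl
    exact hl
  have h2 : (2 * k : ℝ) = 1 := by rw [hk]; norm_num
  have h3 : 2 * k = 1 := by exact_mod_cast h2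
  omega

/-- The real-linear extension of a lattice endomorphism `f` with `E' l m = E (f l) m`, where
`E` and `E'` are the imaginary parts of `H` and `H'`, satisfies the same identity. -/
theorem exists_extension {H H' : V →ₗ[ℂ] V →ₗ⋆[ℂ] ℂ} {f : Λ →ₗ[ℤ] Λ}
    (hf : ∀ l m : Λ, (H' l m).im = (H (f l) m).im) :
    ∃ φ : V →ₗ[ℝ] V, (∀ l : Λ, φ l = f l) ∧ ∀ u v, (H' u v).im = (H (φ u) v).im := by
  obtain ⟨ι, _, b, B, hB, -⟩ := exists_basis Λ
  let φ : V →ₗ[ℝ] V := B.constr ℝ fun i => (f (b i) : V)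
  have hφb : ∀ i, φ (b i) = f (b i) := fun i => by
    rw [← hB, B.constr_basis]
  have hφ : ∀ l : Λ, φ l = f l := fun l => by
    have : (φ.restrictScalars ℤ) ∘ₗ Λ.subtype = Λ.subtype ∘ₗ f := b.ext hφb
    exact LinearMap.congr_fun this l
  let T (K : V →ₗ[ℂ] V →ₗ⋆[ℂ] ℂ) : V →ₗ[ℝ] V →ₗ[ℝ] ℝ := LinearMap.mk₂ ℝ (fun u v => (K u v).im)
    (by simp) (fun c u v => by simp [← Complex.coe_smul]) (by simp)
    (fun c u v => by simp [← Complex.coe_smul])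
  have key : T H' = T H ∘ₗ φ := B.ext fun i => B.ext fun j => by
    change (H' (B i) (B j)).im = (H (φ (B i)) (B j)).im
    rw [hB, hB, hφ, hf]
  exact ⟨φ, hφ, fun u v => LinearMap.congr_fun (LinearMap.congr_fun key u) v⟩

end Lattice

/-! ### Real multiplication -/

/-- In a ring `S` of characteristic zero, a square root of a natural number `d` which is not a
square generates a copy of `ℚ(√d)` in `S ⊗ ℚ`. Characteristic zero ensures that `S ⊗ ℚ` is not the
zero ring, so that the map from the field is injective. -/
theorem exists_subring_ringEquiv_adjoin_sqrt {S : Type*} [Ring S] [CharZero S] {d : ℕ}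
    (hd : ¬ IsSquare d) {x : S} (hx : x * x = d) :
    ∃ R : Subring (S ⊗[ℤ] ℚ), Nonempty (R ≃+* ℚ⟮Real.sqrt (d : ℝ)⟯) := by
  let : Algebra ℚ (S ⊗[ℤ] ℚ) := Algebra.TensorProduct.rightAlgebra
  have hnt : Nontrivial (S ⊗[ℤ] ℚ) :=
    (Algebra.TensorProduct.includeRight_injective (R := ℤ) (A := S) (B := ℚ)
      (RingHom.injective_int _)).nontrivial
  have hsq : Real.sqrt d * Real.sqrt d = d := Real.mul_self_sqrt d.cast_nonneg
  have hirr : Irreducible (Polynomial.X ^ 2 - Polynomial.C (d : ℚ)) := by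
    refine X_pow_sub_C_irreducible_of_prime Nat.prime_two fun q hq => hd ?_
    rw [← Rat.isSquare_natCast_iff]
    exact ⟨q, by rw [← hq, pow_two]⟩
  have hmin : minpoly ℚ (Real.sqrt d) = Polynomial.X ^ 2 - Polynomial.C (d : ℚ) := by
    refine (minpoly.eq_of_irreducible_of_monic hirr ?_
      (Polynomial.monic_X_pow_sub_C _ two_ne_zero)).symm
    simp [pow_two, hsq]
  have hint : IsIntegral ℚ (Real.sqrt d) :=
    ⟨_, Polynomial.monic_X_pow_sub_C (d : ℚ) two_ne_zero, by simp [pow_two, hsq]⟩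
  let f : ℚ⟮Real.sqrt (d : ℝ)⟯ →ₐ[ℚ] S ⊗[ℤ] ℚ :=
    (IntermediateField.adjoin.powerBasis hint).lift (x ⊗ₜ 1) (by
      rw [IntermediateField.adjoin.powerBasis_gen, IntermediateField.minpoly_gen, hmin]
      simp only [map_sub, map_pow, Polynomial.aeval_X, map_natCast]
      rw [pow_two, Algebra.TensorProduct.tmul_mul_tmul, hx, one_mul, sub_eq_zero,
        ← Algebra.TensorProduct.natCast_def])
  exact ⟨f.toRingHom.range, ⟨(RingEquiv.ofBijective f.toRingHom.rangeRestrict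
    ⟨fun a b h => f.toRingHom.injective (congrArg Subtype.val h),
      f.toRingHom.rangeRestrict_surjective⟩).symm⟩⟩

section Torus

variable {V : Type*} [NormedAddCommGroup V] [NormedSpace ℂ V] [FiniteDimensional ℂ V]
  (Λ : Submodule ℤ V)

theorem exists_endRing_of_map_le {ψ : V →ₗ[ℂ] V} (h : ∀ l ∈ Λ, ψ l ∈ Λ) :
    ∃ F : endRing Λ, ∀ v, F.1 (Submodule.Quotient.mk v) = Submodule.Quotient.mk (ψ v) :=
  ⟨⟨(Λ.mapQ Λ (ψ.restrictScalars ℤ) h).toAddMonoidHom, fun v =>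
    ⟨ψ, ψ.toContinuousLinearMap.analyticAt v, Filter.Eventually.of_forall fun _ => rfl⟩⟩,
    fun _ => rfl⟩

/-- Since `V / Λ` is not annihilated by a nonzero integer, `End(A)` has characteristic zero. -/
theorem charZero_endRing [Nontrivial V] [DiscreteTopology Λ] [IsZLattice ℝ Λ] :
    CharZero (endRing Λ) := by
  refine charZero_of_inj_zero fun n hn => by_contra fun hne => ?_
  obtain ⟨v, hv⟩ := exists_zsmul_quotient_ne_zero Λ (n := n) (by exact_mod_cast hne)
  refine hv ?_
  have h := DFunLike.congr_fun (congrArg Subtype.val hn) v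
  simpa using h

/-- A holomorphic endomorphism with characteristic equation `X² - n X + 1`, where `n ≥ 3`, generates
the real quadratic field `ℚ(√(n² - 4))`: the integer `n² - 4` is not a square, since it lies
strictly between `(n - 1)²` and `n²`. -/
theorem admitsRealMultiplication_of_quadratic [Nontrivial V] [DiscreteTopology Λ] [IsZLattice ℝ Λ]
    {ψ : V →ₗ[ℂ] V} (h : ∀ l ∈ Λ, ψ l ∈ Λ) {n : ℕ} (hn : 3 ≤ n)
    (hψ : ∀ v, ψ (ψ v) - n • ψ v + v = 0) : AdmitsRealMultiplication Λ := by
  have := charZero_endRing Λ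
  obtain ⟨F, hF⟩ := exists_endRing_of_map_le Λ h
  have hFF : F * F - n • F + 1 = 0 := by
    refine Subtype.ext (AddMonoidHom.ext fun v => ?_)
    obtain ⟨v, rfl⟩ := Submodule.Quotient.mk_surjective Λ v
    have h1 := congrArg (Submodule.Quotient.mk (p := Λ)) (hψ v)
    rw [Submodule.Quotient.mk_add, Submodule.Quotient.mk_sub, Submodule.Quotient.mk_smul,
      ← hF, ← hF] at h1
    exact h1
  -- With `n = 3 + k`, the integer `n² - 4` is `k² + 6 k + 5`.
  obtain ⟨k, rfl⟩ := Nat.exists_eq_add_of_le hn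
  have hd : ¬ IsSquare (k ^ 2 + 6 * k + 5) := by
    rintro ⟨r, hr⟩
    have h1 : k + 2 < r := by nlinarith
    have h2 : r < k + 3 := by nlinarith
    omega
  refine ⟨k ^ 2 + 6 * k + 5, by omega, hd, exists_subring_ringEquiv_adjoin_sqrt hd
    (x := 2 • F - ((3 + k : ℕ) : endRing Λ)) ?_⟩
  have hc : F * ((3 + k : ℕ) : endRing Λ) = ((3 + k : ℕ) : endRing Λ) * F :=
    (Nat.cast_commute _ F).eq.symm
  have h2 : F * F = ((3 + k : ℕ) : endRing Λ) * F - 1 := by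
    rw [← nsmul_eq_mul, eq_sub_iff_add_eq, ← sub_eq_zero, ← hFF]
    abel
  rw [two_nsmul, sub_mul, mul_sub, mul_sub, add_mul, mul_add, h2, mul_add, add_mul, hc]
  have h3 : ((k ^ 2 + 6 * k + 5 : ℕ) : endRing Λ) =
      ((3 + k : ℕ) : endRing Λ) * ((3 + k : ℕ) : endRing Λ) - (4 : ℕ) := by
    rw [eq_sub_iff_add_eq, ← Nat.cast_mul, ← Nat.cast_add]
    congr 1
    ring
  have h4 : ((4 : ℕ) : endRing Λ) = 1 + 1 + 1 + 1 := by norm_num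
  rw [h3, h4]
  abel

end Torus

/-! ### Two principal polarizations -/

theorem exists_linearEquiv_of_unimodular {M : Type*} [AddCommGroup M]
    {E E' : LinearMap.BilinForm ℤ M} (hE : Function.Bijective (fun l => (E l : Module.Dual ℤ M)))
    (hE' : Function.Bijective (fun l => (E' l : Module.Dual ℤ M))) :
    ∃ f : M ≃ₗ[ℤ] M, ∀ l m, E' l m = E (f l) m := by
  let e : M ≃ₗ[ℤ] Module.Dual ℤ M := LinearEquiv.ofBijective E hE
  let e' : M ≃ₗ[ℤ] Module.Dual ℤ M := LinearEquiv.ofBijective E' hE'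
  exact ⟨e'.trans e.symm, fun l m => (LinearMap.congr_fun (e.apply_symm_apply (e' l)) m).symm⟩

end ComplexTorus

open ComplexTorus in
theorem mainTheorem9 {V : Type*} [NormedAddCommGroup V] [NormedSpace ℂ V]
    (hV : Module.finrank ℂ V = 2) (Λ : Submodule ℤ V) [DiscreteTopology Λ] [IsZLattice ℝ Λ]
    (θ θ' : ComplexTorus.NS Λ)
    (hθ : ComplexTorus.IsPrincipalPolarization θ)
    (hθ' : ComplexTorus.IsPrincipalPolarization θ')
    (hne : θ ≠ θ') :
    ComplexTorus.AdmitsRealMultiplication Λ := by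
  have : FiniteDimensional ℂ V := .of_finrank_pos (by omega)
  have : Nontrivial V := Module.nontrivial_of_finrank_pos (R := ℂ) (by omega)
  obtain ⟨⟨H, hsymm, hpos, hH⟩, hbij⟩ := hθ
  obtain ⟨⟨H', hsymm', hpos', hH'⟩, hbij'⟩ := hθ'
  obtain ⟨f, hf⟩ := exists_linearEquiv_of_unimodular hbij hbij'
  obtain ⟨φ, hφf, hφ⟩ := exists_extension (H := H) (H' := H') (f := f.toLinearMap) Λ fun l m => by
    rw [hH', hf, LinearEquiv.coe_coe, hH]
  obtain ⟨ψ, hψφ, hψ⟩ := exists_complexLinear_of_im_eq hpos φ hφ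
  have hψf : ∀ l : Λ, ψ l = f l := fun l => (hψφ l).trans (hφf l)
  obtain ⟨a, b, ha, hb, hdet, hquad⟩ := exists_eigenvalues_of_finrank_eq_two hV ψ
  obtain ⟨r, hr, rfl⟩ := exists_pos_of_hasEigenvalue hsymm hsymm' hpos hpos' hψ ha
  obtain ⟨s, hs, rfl⟩ := exists_pos_of_hasEigenvalue hsymm hsymm' hpos hpos' hψ hb
  -- The determinant of `ψ` over `ℝ` is `(r s)²`, and it is a unit of `ℤ`.
  have hrs : r * s = 1 := by
    have h1 : LinearMap.det (ψ.restrictScalars ℝ) = (LinearMap.det f.toLinearMap : ℤ) :=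
      det_eq_of_extends Λ hψf
    rw [LinearMap.det_restrictScalars, hdet, Algebra.norm_complex_apply, ← Complex.ofReal_mul,
      Complex.normSq_ofReal] at h1
    obtain h2 | h2 := Int.isUnit_iff.1 f.isUnit_det'
    · rw [h2] at h1
      push_cast at h1
      nlinarith [mul_pos hr hs]
    · rw [h2] at h1
      push_cast at h1
      nlinarith [mul_pos hr hs]
  have hquad' : ∀ v, ψ (ψ v) - (r + s) • ψ v + v = 0 := fun v => by
    have h := hquad v
    rwa [← Complex.ofReal_mul, hrs, Complex.ofReal_one, one_smul, ← Complex.ofReal_add,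
      Complex.coe_smul] at h
  -- The trace preserves `Λ = ψ(Λ)`, since `(r + s) ψ = ψ² + 1`.
  obtain ⟨n, hn⟩ := exists_int_eq_of_smul_mem Λ (t := r + s) fun l => by
    have h := hquad' (f.symm l)
    rw [hψf, f.apply_symm_apply, hψf, sub_add_eq_add_sub, sub_eq_zero] at h
    exact h ▸ (f l + f.symm l).2
  -- As `r s = 1`, this identity shows that `r + s ≥ 2`.
  have hsq : (r + s - 2) * (r + s + 2) = (r - s) ^ 2 := by linear_combination 4 * hrs
  have hn2 : n ≠ 2 := by
    rintro rfl
    refine hne (Subtype.ext (LinearMap.ext fun l => LinearMap.ext fun m => ?_))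
    have h1 : ψ l = l := by
      refine apply_eq_self_of_unipotent hsymm hsymm' hpos hψ (fun v => ?_) l
      have h := hquad' v
      rwa [← hn, ← Complex.coe_smul, Int.cast_ofNat, Complex.ofReal_ofNat] at h
    rw [hf, Subtype.ext ((hψf l).symm.trans h1)]
  have hn3 : 3 ≤ n := by
    have h1 : (2 : ℝ) ≤ n := by
      rw [hn]
      nlinarith [sq_nonneg (r - s)]
    have h2 : 2 ≤ n := by exact_mod_cast h1
    omega
  lift n to ℕ using by omega
  refine admitsRealMultiplication_of_quadratic Λ (n := n)
    (fun l hl => hψf ⟨l, hl⟩ ▸ (f ⟨l, hl⟩).2) (by exact_mod_cast hn3) fun v => ?_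
  rw [← Nat.cast_smul_eq_nsmul ℝ, ← hquad' v, ← hn, Int.cast_natCast]
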